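/- A probabilistic weighted automaton over a finite alphabet $\Sigma$ consists of a finite set $Q$ of states, an initial probability distribution $\rho_I$ on $Q$, a probabilistic transition function $\delta$ assigning to each $(q,\sigma)\in Q\times\Sigma$ a probability distribution on $Q$, and a weight function $\gamma:Q\times\Sigma\times Q\to\mathbb{Q}$. For an infinite word $w=\sigma_1\sigma_2\dots\in\Sigma^\omega$, a run over $w$ is a sequence $r=q_0q_1\dots$ of states with $\rho_I(q_0)>0$ and $\delta(q_i,\sigma_{i+1})(q_{i+1})>0$ for all $i\ge 0$; its weight sequence is $\gamma(r)=v_0v_1\dots$ with $v_i=\gamma(q_i,\sigma_{i+1},q_{i+1})$. Let $\mathbb{P}^A$ be the unique probability measure on infinite state sequences that gives each finite prefix $q_0\dots q_k$ the probability $\rho_I(q_0)\prod_{i=1}^{k}\delta(q_{i-1},\sigma_i)(q_i)$. Put $\mathsf{LimAvg}(v)=\liminf_{n\to\infty}\frac1n\sum_{i=0}^{n-1}v_i$. Under the positive semantics $A$ generates the quantitative language $$L_A^{>0}(w)=\sup\{\eta\in\mathbb{R} \mid \mathbb{P}^A(\{r \text{ a run over } w \mid \mathsf{LimAvg}(\gamma(r))\ge\eta\})>0\},$$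 and under the almost-sure semantics it generates $$L_A^{=1}(w)=\sup\{\eta\in\mathbb{R} \mid \mathbb{P}^A(\{r \text{ a run over } w \mid \mathsf{LimAvg}(\gamma(r))\ge\eta\})=1\}.$$ A quantitative language $L:\Sigma^\omega\to\mathbb{R}$ is PosLimAvg-definable (resp. AsLimAvg-definable) if $L=L_A^{>0}$ (resp. $L=L_A^{=1}$) for some such $A$. A class of quantitative languages is closed under $\min$ (resp. $\max$) if, for every finite alphabet $\Sigma$ and all $L,L':\Sigma^\omega\to\mathbb{R}$ in the class, the pointwise $\min(L,L')$ (resp. $\max(L,L')$) is in the class. Let $\Sigma=\{a,b\}$ and, for $c\in\Sigma$ and $w=\sigma_1\sigma_2\dots$, let $L_c(w)=\liminf_{n\to\infty}\frac1n|\{1\le i\le n\mid \sigma_i=c\}|$. **Lemma.** 1. $L_a$ and $L_b$ are PosLimAvg-definable, but neither $\min(L_a,L_b)$ nor $1-\max(L_a,L_b)$ is PosLimAvg-definable. 2. $L_a$ and $L_b$ are AsLimAvg-definable, but $\max(L_a,L_b)$ is not AsLimAvg-definable. In particular, the class of PosLimAvg-definable languages is not closed under $\min$, and the class of AsLimAvg-definable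 languages is not closed under $\max$. -/

import Mathlib

open MeasureTheory ProbabilityTheory

/-- Infinite words over the alphabet `S`. -/
abbrev InfWord (S : Type*) : Type _ := ℕ → S

/-- Quantitative languages over the alphabet `S`. -/
abbrev QuantLanguage (S : Type*) : Type _ := InfWord S → ℝ

/-- The limit-average value `liminf_n (1/n) ∑_{i<n} v_i` of a sequence of rational numbers
(only ever applied to bounded sequences). -/
noncomputable def limAvg (v : ℕ → ℚ) : ℝ :=
  Filter.liminf (fun n : ℕ => (1 / (n : ℝ)) * ∑ i ∈ Finset.range n, (v i : ℝ)) Filter.atTop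

/-- A probabilistic weighted automaton with state set `Q` over the alphabet `S`. -/
structure ProbWeightedAutomaton (Q S : Type*) where
  /-- the initial distribution -/
  init : PMF Q
  /-- the probabilistic transition function -/
  trans : Q → S → PMF Q
  /-- the (rational) weight of every transition -/
  weight : Q → S → Q → ℚ

namespace ProbWeightedAutomaton

/-- The infinite runs of `A` over `w`; the letter read at step `i` is `w i`, so a run is
given by its sequence of states. -/
def runs {Q S : Type*} (A : ProbWeightedAutomaton Q S) (w : InfWord S) : Set (ℕ → Q) :=
  {r | 0 < A.init (r 0) ∧ ∀ i, 0 < A.trans (r i) (w i) (r (i + 1))}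

/-- The sequence of weights along a run. -/
def weights {Q S : Type*} (A : ProbWeightedAutomaton Q S) (w : InfWord S) (r : ℕ → Q) : ℕ → ℚ :=
  fun i => A.weight (r i) (w i) (r (i + 1))

/-- The transition kernel at step `n` on the word `w`: the next state is drawn from
`A.trans q (w n)`, where `q` is the last state of the history. -/
noncomputable def stepKernel {Q S : Type*} [Finite Q] [MeasurableSpace Q]
    [DiscreteMeasurableSpace Q] (A : ProbWeightedAutomaton Q S) (w : InfWord S) (n : ℕ) :
    Kernel (∀ _ : Finset.Iic n, Q) Q where
  toFun x := (A.trans (x ⟨n, Finset.mem_Iic.2 le_rfl⟩) (w n)).toMeasure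
  measurable' :=
    (Measurable.of_discrete (f := fun q : Q => (A.trans q (w n)).toMeasure)).comp
      (measurable_pi_apply _)

instance {Q S : Type*} [Finite Q] [MeasurableSpace Q] [DiscreteMeasurableSpace Q]
    (A : ProbWeightedAutomaton Q S) (w : InfWord S) (n : ℕ) :
    IsMarkovKernel (A.stepKernel w n) :=
  ⟨fun x => PMF.toMeasure.isProbabilityMeasure (A.trans (x ⟨n, Finset.mem_Iic.2 le_rfl⟩) (w n))⟩

/-- The probability measure on infinite sequences of states induced by `A` on the word `w`. -/
noncomputable def runMeasure {Q S : Type*} [Finite Q] [MeasurableSpace Q]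
    [DiscreteMeasurableSpace Q] (A : ProbWeightedAutomaton Q S) (w : InfWord S) :
    Measure (ℕ → Q) :=
  Kernel.trajMeasure (X := fun _ => Q) A.init.toMeasure (A.stepKernel w)

instance {Q S : Type*} [Finite Q] [MeasurableSpace Q] [DiscreteMeasurableSpace Q]
    (A : ProbWeightedAutomaton Q S) (w : InfWord S) : IsProbabilityMeasure (A.runMeasure w) :=
  haveI : IsProbabilityMeasure A.init.toMeasure := PMF.toMeasure.isProbabilityMeasure _
  inferInstanceAs (IsProbabilityMeasure
    (Kernel.trajMeasure (X := fun _ => Q) A.init.toMeasure (A.stepKernel w)))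

/-- `runMeasure` gives finite runs their usual probability, which determines it uniquely. -/
theorem runMeasure_cylinder {Q S : Type*} [Finite Q] [MeasurableSpace Q]
    [DiscreteMeasurableSpace Q] (A : ProbWeightedAutomaton Q S) (w : InfWord S)
    (q : ℕ → Q) (k : ℕ) :
    A.runMeasure w {r | ∀ i ≤ k, r i = q i} =
      A.init (q 0) * ∏ i ∈ Finset.range k, A.trans (q i) (w i) (q (i + 1)) := by
  have : IsProbabilityMeasure A.init.toMeasure := PMF.toMeasure.isProbabilityMeasure _
  induction k with
  | zero =>
    have h0 : {r : ℕ → Q | ∀ i ≤ 0, r i = q i} = (Preorder.frestrictLe (π := fun _ => Q) 0) ⁻¹'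
        {x | x ⟨0, Finset.mem_Iic.2 le_rfl⟩ = q 0} := by
      ext r
      simp [Preorder.frestrictLe]
    have hm : MeasurableSet {x : ∀ _ : Finset.Iic 0, Q |
        x ⟨0, Finset.mem_Iic.2 le_rfl⟩ = q 0} :=
      measurableSet_eq_fun (measurable_pi_apply _) measurable_const
    rw [h0, ← Measure.map_apply (by fun_prop) hm, runMeasure, Kernel.trajMeasure,
      Measure.map_comp _ _ (by fun_prop), Kernel.traj_map_frestrictLe, Kernel.partialTraj_self,
      Measure.id_comp, Measure.map_apply (by fun_prop) hm]
    have h1 : (MeasurableEquiv.piUnique (fun _ : Finset.Iic 0 => Q)).symm ⁻¹'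
        {x : ∀ _ : Finset.Iic 0, Q | x ⟨0, Finset.mem_Iic.2 le_rfl⟩ = q 0} = {q 0} := by
      ext y
      rfl
    simp only [Finset.range_zero, Finset.prod_empty, mul_one]
    rw [← PMF.toMeasure_apply_singleton A.init (q 0) (measurableSet_singleton _), ← h1]
  | succ k ih =>
    have hs : MeasurableSet {x : ∀ _ : Finset.Iic k, Q | ∀ i : Finset.Iic k, x i = q i} := by
      have : {x : ∀ _ : Finset.Iic k, Q | ∀ i : Finset.Iic k, x i = q i} = ⋂ i : Finset.Iic k, {x : ∀ _ : Finset.Iic k, Q | x i = q i} := by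
        ext x
        simp
      rw [this]
      exact MeasurableSet.iInter fun i =>
        measurableSet_eq_fun (measurable_pi_apply _) measurable_const
    have h1 : {r : ℕ → Q | ∀ i ≤ k + 1, r i = q i} =
        (fun x : ℕ → Q => (Preorder.frestrictLe (π := fun _ => Q) k x, x (k + 1))) ⁻¹'
          ({x : ∀ _ : Finset.Iic k, Q | ∀ i : Finset.Iic k, x i = q i} ×ˢ {q (k + 1)}) := by
      ext r
      simp only [Set.mem_ofPred_eq, Set.mem_preimage, Set.mem_prod, Set.mem_singleton_iff,
        Preorder.frestrictLe_apply, Subtype.forall, Finset.mem_Iic]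
      constructor
      · exact fun h => ⟨fun i hi => h i (by omega), h _ le_rfl⟩
      · rintro ⟨h, h'⟩ i hi
        rcases Nat.lt_or_ge k i with hk | hk
        · obtain rfl : i = k + 1 := by omega
          exact h'
        · exact h i hk
    have h2 : {r : ℕ → Q | ∀ i ≤ k, r i = q i} =
        (Preorder.frestrictLe (π := fun _ => Q) k) ⁻¹' {x : ∀ _ : Finset.Iic k, Q | ∀ i : Finset.Iic k, x i = q i} := by
      ext r
      simp [Preorder.frestrictLe_apply]
    rw [h2, ← Measure.map_apply (by fun_prop) hs] at ih
    rw [h1, ← Measure.map_apply (by fun_prop) (hs.prod (measurableSet_singleton _)), runMeasure,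
      ← Kernel.map_frestrictLe_trajMeasure_compProd_eq_map_trajMeasure (X := fun _ => Q)
        (κ := A.stepKernel w) (a := k),
      Measure.compProd_apply_prod hs (measurableSet_singleton _),
      setLIntegral_congr_fun (g := fun _ => A.trans (q k) (w k) (q (k + 1))) hs ?_,
      setLIntegral_const, Finset.prod_range_succ, ← mul_assoc, ← ih, mul_comm]
    · rfl
    · intro x hx
      have hk : x ⟨k, Finset.mem_Iic.2 le_rfl⟩ = q k := hx _
      change (A.trans (x ⟨k, Finset.mem_Iic.2 le_rfl⟩) (w k)).toMeasure {q (k + 1)} = _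
      rw [hk, PMF.toMeasure_apply_singleton _ _ (measurableSet_singleton _)]

/-- The value of `w` under the almost-sure semantics. -/
noncomputable def asValue {Q S : Type*} [Finite Q] [MeasurableSpace Q]
    [DiscreteMeasurableSpace Q] (Val : (ℕ → ℚ) → ℝ) (A : ProbWeightedAutomaton Q S) :
    QuantLanguage S :=
  fun w => sSup {η : ℝ | A.runMeasure w {r | r ∈ A.runs w ∧ η ≤ Val (A.weights w r)} = 1}

/-- The value of `w` under the positive semantics. -/
noncomputable def posValue {Q S : Type*} [Finite Q] [MeasurableSpace Q]
    [DiscreteMeasurableSpace Q] (Val : (ℕ → ℚ) → ℝ) (A : ProbWeightedAutomaton Q S) :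
    QuantLanguage S :=
  fun w => sSup {η : ℝ | 0 < A.runMeasure w {r | r ∈ A.runs w ∧ η ≤ Val (A.weights w r)}}

end ProbWeightedAutomaton

/-- The quantitative languages over `S` generated by a (finite-state) probabilistic
`LimAvg`-automaton under the positive semantics. -/
def PosLimAvg (S : Type) : Set (QuantLanguage S) :=
  {L | ∃ (Q : Type) (_ : Finite Q) (_ : MeasurableSpace Q) (_ : DiscreteMeasurableSpace Q)
    (A : ProbWeightedAutomaton Q S), A.posValue limAvg = L}

/-- The quantitative languages over `S` generated by a (finite-state) probabilistic
`LimAvg`-automaton under the almost-sure semantics. -/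
def AsLimAvg (S : Type) : Set (QuantLanguage S) :=
  {L | ∃ (Q : Type) (_ : Finite Q) (_ : MeasurableSpace Q) (_ : DiscreteMeasurableSpace Q)
    (A : ProbWeightedAutomaton Q S), A.asValue limAvg = L}

/-- A class of quantitative languages (over all finite alphabets) is closed under `min`. -/
def ClosedUnderMin (C : ∀ S : Type, Set (QuantLanguage S)) : Prop :=
  ∀ (S : Type) [Finite S] (L L' : QuantLanguage S), L ∈ C S → L' ∈ C S →
    (fun w => min (L w) (L' w)) ∈ C S

/-- A class of quantitative languages (over all finite alphabets) is closed under `max`. -/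
def ClosedUnderMax (C : ∀ S : Type, Set (QuantLanguage S)) : Prop :=
  ∀ (S : Type) [Finite S] (L L' : QuantLanguage S), L ∈ C S → L' ∈ C S →
    (fun w => max (L w) (L' w)) ∈ C S

/-- The two-letter alphabet `{a, b}`. -/
inductive Letter
  | a
  | b
  deriving DecidableEq

/-- The language assigning to `w` the long-run average number of occurrences of the
letter `c`. -/
noncomputable def letterFreq (c : Letter) : QuantLanguage Letter :=
  fun w => limAvg (fun i => if w i = c then 1 else 0)

/-!
Fix a letter `s`. The weights of a finite automaton that reads `s` forever admit a Poisson
decomposition: a gain `g s`, harmonic for the Markov chain of `s`, and a bias `h s` whose drift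
accounts for the rest. On a word whose letter changes with density zero the bias telescopes up to
sublinear terms, and a law of large numbers for orthogonal increments removes the fluctuations, so
that almost surely the average weight follows the average of the gains `g (w i) (r i)`.

By the maximum principle the reachable states of maximal gain `g s` are closed under `s`, so this
maximum is the limit average, with positive probability, on some word that ends with `s` forever;
likewise for the minimum. Hence bounds on the value of all ultimately constant words carry over to
all slowly switching words. The minimum, and one minus the maximum, of the two letter frequencies
vanish on ultimately constant words but equal `1 / 2` on the word with blocks of lengths
`1, 3, 5, …`.
-/

open Filter Topology

/-- The `n`-th Cesàro mean `(u 0 + ⋯ + u (n - 1)) / n` of a real sequence; it is `0` at `n = 0`. -/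
noncomputable def cesaroMean (u : ℕ → ℝ) (n : ℕ) : ℝ :=
  (∑ i ∈ Finset.range n, u i) / n

section CesaroMean

variable {u v : ℕ → ℝ} {c : ℝ}

theorem cesaroMean_add (u v : ℕ → ℝ) (n : ℕ) :
    cesaroMean (fun i => u i + v i) n = cesaroMean u n + cesaroMean v n := by
  simp only [cesaroMean, Finset.sum_add_distrib, add_div]

theorem cesaroMean_sub (u v : ℕ → ℝ) (n : ℕ) :
    cesaroMean (fun i => u i - v i) n = cesaroMean u n - cesaroMean v n := by
  simp only [cesaroMean, Finset.sum_sub_distrib, sub_div]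

theorem cesaroMean_const_mul (c : ℝ) (u : ℕ → ℝ) (n : ℕ) :
    cesaroMean (fun i => c * u i) n = c * cesaroMean u n := by
  simp only [cesaroMean, ← Finset.mul_sum, mul_div_assoc]

theorem cesaroMean_const (c : ℝ) {n : ℕ} (hn : n ≠ 0) : cesaroMean (fun _ => c) n = c := by
  simp [cesaroMean, hn]

theorem cesaroMean_mono (h : ∀ i, u i ≤ v i) (n : ℕ) : cesaroMean u n ≤ cesaroMean v n :=
  div_le_div_of_nonneg_right (Finset.sum_le_sum fun i _ => h i) n.cast_nonneg

theorem abs_cesaroMean_le (u : ℕ → ℝ) (n : ℕ) :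
    |cesaroMean u n| ≤ cesaroMean (fun i => |u i|) n := by
  rw [cesaroMean, abs_div, Nat.abs_cast]
  exact div_le_div_of_nonneg_right (Finset.abs_sum_le_sum_abs _ _) n.cast_nonneg

theorem tendsto_cesaroMean (h : Tendsto u atTop (𝓝 c)) : Tendsto (cesaroMean u) atTop (𝓝 c) :=
  h.cesaro.congr fun _ => inv_mul_eq_div _ _

theorem tendsto_cesaroMean_of_abs_le (h : ∀ i, |u i| ≤ c * v i)
    (hv : Tendsto (cesaroMean v) atTop (𝓝 0)) : Tendsto (cesaroMean u) atTop (𝓝 0) := by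
  refine squeeze_zero_norm (fun n => ?_) (by simpa using hv.const_mul c)
  rw [← cesaroMean_const_mul]
  exact (abs_cesaroMean_le u n).trans (cesaroMean_mono h n)

theorem tendsto_cesaroMean_sub_succ (h : Tendsto (fun n : ℕ => u n / n) atTop (𝓝 0)) :
    Tendsto (cesaroMean fun i => u (i + 1) - u i) atTop (𝓝 0) := by
  have hlim := h.sub (tendsto_const_div_atTop_nhds_zero_nat (u 0))
  rw [sub_zero] at hlim
  exact hlim.congr fun n => by rw [cesaroMean, Finset.sum_range_sub, sub_div]

theorem tendsto_cesaroMean_of_tendsto_sq (hu : ∀ i, |u i| ≤ c)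
    (h : Tendsto (fun k : ℕ => cesaroMean u (k ^ 2)) atTop (𝓝 0)) :
    Tendsto (cesaroMean u) atTop (𝓝 0) := by
  -- Adding the constant `c` makes the partial sums monotone.
  have hmean : ∀ n : ℕ, n ≠ 0 → cesaroMean (fun i => u i + c) n = cesaroMean u n + c :=
    fun n hn => by rw [cesaroMean_add, cesaroMean_const c hn]
  have hmono : Monotone fun n => ∑ i ∈ Finset.range n, (u i + c) :=
    monotone_nat_of_le_succ fun n => by
      rw [Finset.sum_range_succ]
      linarith [(abs_le.1 (hu n)).1]
  have hratio : Tendsto (fun n : ℕ => ((1 + n : ℝ) / n) ^ 2) atTop (𝓝 1) := by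
    simpa using (tendsto_add_mul_div_add_mul_atTop_nhds (𝕜 := ℝ) 1 0 1 one_ne_zero).pow 2
  have hshift : Tendsto (cesaroMean fun i => u i + c) atTop (𝓝 c) := by
    refine tendsto_div_of_monotone_of_exists_subseq_tendsto_div _ c hmono fun a ha =>
      ⟨fun k => k ^ 2, ?_, tendsto_pow_atTop two_ne_zero, ?_⟩
    · filter_upwards [hratio.eventually_le_const ha, eventually_gt_atTop 0] with n hn hn0
      rwa [div_pow, div_le_iff₀ (by positivity), add_comm, ← Nat.cast_succ, ← Nat.cast_pow,
        ← Nat.cast_pow] at hn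
    · refine (by simpa using h.add_const c : Tendsto _ _ (𝓝 c)).congr' ?_
      filter_upwards [eventually_ne_atTop 0] with k hk using (hmean _ (pow_ne_zero 2 hk)).symm
  refine (by simpa using hshift.sub_const c : Tendsto _ _ (𝓝 (0 : ℝ))).congr' ?_
  filter_upwards [eventually_ne_atTop 0] with n hn
  rw [hmean n hn, add_sub_cancel_right]

end CesaroMean

section LimAvg

variable {v : ℕ → ℚ} {x : ℕ → ℝ} {B c : ℝ}

theorem limAvg_eq_liminf_cesaroMean (v : ℕ → ℚ) :
    limAvg v = liminf (cesaroMean fun i => (v i : ℝ)) atTop := by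
  simp only [limAvg, one_div_mul_eq_div]
  rfl

theorem limAvg_eq_of_tendsto (h : Tendsto (cesaroMean fun i => (v i : ℝ)) atTop (𝓝 c)) :
    limAvg v = c := by
  rw [limAvg_eq_liminf_cesaroMean, h.liminf_eq]

theorem limAvg_le_of_tendsto_sub (hv : ∀ i, B ≤ v i) (hx : ∀ i, x i ≤ c)
    (h : Tendsto (cesaroMean fun i => v i - x i) atTop (𝓝 0)) : limAvg v ≤ c := by
  rw [limAvg_eq_liminf_cesaroMean]
  have hbdd : IsBoundedUnder (· ≥ ·) atTop (cesaroMean fun i => (v i : ℝ)) :=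
    isBoundedUnder_of_eventually_ge <| (eventually_ne_atTop 0).mono fun n hn =>
      (cesaroMean_const B hn).ge.trans (cesaroMean_mono hv n)
  refine le_of_forall_pos_le_add fun ε hε =>
    liminf_le_of_frequently_le (Eventually.frequently ?_) hbdd
  filter_upwards [h.eventually_le_const hε, eventually_ne_atTop 0] with n hn hn0
  rw [cesaroMean_sub] at hn
  linarith [(cesaroMean_mono hx n).trans_eq (cesaroMean_const c hn0)]

theorem le_limAvg_of_tendsto_sub (hv : ∀ i, v i ≤ B) (hx : ∀ i, c ≤ x i)
    (h : Tendsto (cesaroMean fun i => v i - x i) atTop (𝓝 0)) : c ≤ limAvg v := by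
  rw [limAvg_eq_liminf_cesaroMean]
  have hbdd : IsBoundedUnder (· ≤ ·) atTop (cesaroMean fun i => (v i : ℝ)) :=
    isBoundedUnder_of_eventually_le <| (eventually_ne_atTop 0).mono fun n hn =>
      (cesaroMean_mono hv n).trans (cesaroMean_const B hn).le
  refine le_of_forall_pos_sub_le fun ε hε => le_liminf_of_le hbdd.isCoboundedUnder_ge ?_
  filter_upwards [h.eventually_const_le (neg_lt_zero.2 hε), eventually_ne_atTop 0] with n hn hn0
  rw [cesaroMean_sub] at hn
  linarith [(cesaroMean_const c hn0).symm.trans_le (cesaroMean_mono hx n)]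

theorem abs_limAvg_le (hv : ∀ i, |(v i : ℝ)| ≤ B) : |limAvg v| ≤ B := by
  have hle : ∀ i, (v i : ℝ) ≤ B := fun i => (abs_le.1 (hv i)).2
  have hge : ∀ i, -B ≤ (v i : ℝ) := fun i => (abs_le.1 (hv i)).1
  have hself : Tendsto (cesaroMean fun i => (v i : ℝ) - v i) atTop (𝓝 0) := by
    simp only [sub_self]
    exact tendsto_cesaroMean tendsto_const_nhds
  exact abs_le.2 ⟨le_limAvg_of_tendsto_sub hle hge hself, limAvg_le_of_tendsto_sub hge hle hself⟩

end LimAvg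

section PoissonEquation

variable {𝕜 V : Type*} [RCLike 𝕜] [NormedAddCommGroup V] [NormedSpace 𝕜 V] {T : V →ₗ[𝕜] V}

theorem disjoint_ker_range_sub_one (hT : ∀ x, Bornology.IsBounded (Set.range fun n => T^[n] x)) :
    Disjoint (LinearMap.ker (T - 1)) (LinearMap.range (T - 1)) := by
  rw [Submodule.disjoint_def]
  rintro _ hfix ⟨x, rfl⟩
  -- The Birkhoff averages of a coboundary tend to `0`, those of a fixed point are constant.
  have hzero := tendsto_birkhoffAverage_apply_sub_birkhoffAverage (g := id) 𝕜 (hT x)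
  have hself := Function.IsFixedPt.tendsto_birkhoffAverage 𝕜
    (f := T) (x := (T - 1) x) (sub_eq_zero.1 hfix) id
  have hsub : ∀ n x y, T^[n] (x - y) = T^[n] x - T^[n] y := iterate_map_sub (T : V →+ V)
  refine tendsto_nhds_unique hself (hzero.congr fun n => ?_)
  simp [birkhoffAverage, birkhoffSum, hsub, smul_sub]

theorem exists_poisson_solution [FiniteDimensional 𝕜 V]
    (hT : ∀ x, Bornology.IsBounded (Set.range fun n => T^[n] x)) (v : V) :
    ∃ g h : V, T g = g ∧ v + T h = g + h := by
  have hsup : LinearMap.ker (T - 1) ⊔ LinearMap.range (T - 1) = ⊤ :=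
    Submodule.eq_top_of_disjoint _ _
      (by rw [add_comm, LinearMap.finrank_range_add_finrank_ker]) (disjoint_ker_range_sub_one hT)
  obtain ⟨g, hg, _, ⟨h, rfl⟩, hgh⟩ := Submodule.mem_sup.1 (hsup ▸ Submodule.mem_top : v ∈ _)
  refine ⟨g, -h, sub_eq_zero.1 hg, ?_⟩
  rw [← hgh, LinearMap.sub_apply, Module.End.one_apply, map_neg]
  abel

end PoissonEquation

section StrongLaw

variable {Ω : Type*} [MeasurableSpace Ω] {μ : Measure Ω}

theorem integral_sq_sum_of_pairwise_orthogonal {ι : Type*} {D : ι → Ω → ℝ}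
    (hD : ∀ i, MemLp (D i) 2 μ) (horth : Pairwise fun i j => ∫ ω, D i ω * D j ω ∂μ = 0)
    (s : Finset ι) :
    ∫ ω, (∑ i ∈ s, D i ω) ^ 2 ∂μ = ∑ i ∈ s, ∫ ω, D i ω ^ 2 ∂μ := by
  have hint : ∀ i j, Integrable (fun ω => D i ω * D j ω) μ := fun i j =>
    (hD i).integrable_mul (hD j)
  simp_rw [sq, Finset.sum_mul_sum]
  rw [integral_finsetSum _ fun i _ => integrable_finsetSum _ fun j _ => hint i j]
  refine Finset.sum_congr rfl fun i hi => ?_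
  rw [integral_finsetSum _ fun j _ => hint i j]
  exact Finset.sum_eq_single_of_mem i hi fun j _ hji => horth hji.symm

theorem ae_summable_norm_of_summable_integral_norm {ι E : Type*} [Countable ι]
    [NormedAddCommGroup E] {f : ι → Ω → E} (hf : ∀ k, Integrable (f k) μ)
    (hsum : Summable fun k => ∫ ω, ‖f k ω‖ ∂μ) :
    ∀ᵐ ω ∂μ, Summable fun k => ‖f k ω‖ := by
  refine summable_norm_of_tsum_eLpNorm_ne_top le_rfl (fun k => (hf k).1) ?_
  simp_rw [eLpNorm_one_eq_lintegral_enorm, ← ofReal_integral_norm_eq_lintegral_enorm (hf _)]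
  exact hsum.tsum_ofReal_ne_top

theorem ae_tendsto_cesaroMean_of_pairwise_orthogonal [IsFiniteMeasure μ] {D : ℕ → Ω → ℝ} {C : ℝ}
    (hmeas : ∀ i, AEStronglyMeasurable (D i) μ) (hbound : ∀ i, ∀ᵐ ω ∂μ, |D i ω| ≤ C)
    (horth : Pairwise fun i j => ∫ ω, D i ω * D j ω ∂μ = 0) :
    ∀ᵐ ω ∂μ, Tendsto (cesaroMean fun i => D i ω) atTop (𝓝 0) := by
  have hL2 : ∀ i, MemLp (D i) 2 μ := fun i => MemLp.of_bound (hmeas i) C (hbound i)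
  have hL2mean : ∀ n, MemLp (fun ω => cesaroMean (fun i => D i ω) n) 2 μ := fun n => by
    simpa only [cesaroMean, div_eq_inv_mul] using
      (memLp_finsetSum (Finset.range n) fun i _ => hL2 i).const_mul (n : ℝ)⁻¹
  have hsq : ∀ i, ∫ ω, D i ω ^ 2 ∂μ ≤ C ^ 2 * μ.real Set.univ := fun i => by
    refine (Real.le_norm_self _).trans (norm_integral_le_of_norm_le_const ?_)
    filter_upwards [hbound i] with ω hω
    rw [norm_pow]
    exact pow_le_pow_left₀ (norm_nonneg _) hω 2
  -- The variance of the mean of `n` terms is `O(1 / n)`, hence summable along the squares.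
  have hvar : ∀ n : ℕ, ∫ ω, cesaroMean (fun i => D i ω) n ^ 2 ∂μ ≤ C ^ 2 * μ.real Set.univ / n :=
    fun n => by
      simp only [cesaroMean, div_pow]
      rw [integral_div, integral_sq_sum_of_pairwise_orthogonal hL2 horth, sq (n : ℝ), ← div_div]
      gcongr
      refine div_le_of_le_mul₀ n.cast_nonneg (by positivity)
        ((Finset.sum_le_sum fun i _ => hsq i).trans_eq ?_)
      rw [Finset.sum_const, Finset.card_range, nsmul_eq_mul, mul_comm]
  have hsum : Summable fun k : ℕ => ∫ ω, ‖cesaroMean (fun i => D i ω) (k ^ 2) ^ 2‖ ∂μ := by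
    refine .of_nonneg_of_le (fun k => by positivity) (fun k => ?_)
      ((Real.summable_one_div_nat_pow.2 one_lt_two).mul_left (C ^ 2 * μ.real Set.univ))
    have hvar_sq := hvar (k ^ 2)
    push_cast at hvar_sq
    simpa only [norm_pow, Real.norm_eq_abs, sq_abs, mul_one_div] using hvar_sq
  filter_upwards [ae_all_iff.2 hbound,
    ae_summable_norm_of_summable_integral_norm (fun k => (hL2mean (k ^ 2)).integrable_sq) hsum]
    with ω hω hsummable
  refine tendsto_cesaroMean_of_tendsto_sq hω ((tendsto_zero_iff_abs_tendsto_zero _).2 ?_)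
  simpa [Function.comp_def, Real.sqrt_sq_eq_abs] using hsummable.tendsto_atTop_zero.sqrt

end StrongLaw

section Trajectories

theorem integral_trajMeasure_frestrictLe_succ {X : ℕ → Type*} [∀ n, MeasurableSpace (X n)]
    {E : Type*} [NormedAddCommGroup E] [NormedSpace ℝ E] {μ₀ : Measure (X 0)}
    [IsProbabilityMeasure μ₀] {κ : ∀ n, Kernel (∀ i : Finset.Iic n, X i) (X (n + 1))}
    [∀ n, IsMarkovKernel (κ n)] {n : ℕ} {f : (∀ i : Finset.Iic n, X i) × X (n + 1) → E}
    (hf : Integrable f ((Kernel.trajMeasure μ₀ κ).map (Preorder.frestrictLe n) ⊗ₘ κ n)) :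
    ∫ x, f (Preorder.frestrictLe n x, x (n + 1)) ∂Kernel.trajMeasure μ₀ κ =
      ∫ x, ∫ y, f (Preorder.frestrictLe n x, y) ∂κ n (Preorder.frestrictLe n x)
        ∂Kernel.trajMeasure μ₀ κ := by
  have hjoint := Kernel.map_frestrictLe_trajMeasure_compProd_eq_map_trajMeasure
    (μ₀ := μ₀) (κ := κ) (a := n)
  rw [← integral_map (φ := fun x => (Preorder.frestrictLe n x, x (n + 1))) (by fun_prop)
    (hjoint ▸ hf.1), ← hjoint, Measure.integral_compProd hf]
  exact integral_map (by fun_prop) hf.1.integral_kernel_compProd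

theorem ae_measure_preimage_singleton_ne_zero {Ω β : Type*} [MeasurableSpace Ω] [Countable β]
    (μ : Measure Ω) (f : Ω → β) : ∀ᵐ ω ∂μ, μ (f ⁻¹' {f ω}) ≠ 0 := by
  have hnull := (measure_preimage_eq_zero_iff_of_countable (μ := μ) (f := f)
    (Set.to_countable {x | μ (f ⁻¹' {x}) = 0})).2 fun _ hx => hx
  simpa [ae_iff] using hnull

end Trajectories

namespace ProbWeightedAutomaton

variable {Q S : Type*} [Finite Q] [MeasurableSpace Q] [DiscreteMeasurableSpace Q]

/-- The Markov operator of the letter `s`: it sends `f` to the function whose value at `q` is the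
expectation of `f` at the successor of `q`. -/
noncomputable def transitionOp (A : ProbWeightedAutomaton Q S) (s : S) : (Q → ℝ) →ₗ[ℝ] Q → ℝ where
  toFun f q := ∫ q', f q' ∂(A.trans q s).toMeasure
  map_add' _ _ := funext fun _ => integral_add .of_finite .of_finite
  map_smul' _ _ := funext fun _ => integral_const_mul _ _

theorem transitionOp_apply (A : ProbWeightedAutomaton Q S) (s : S) (f : Q → ℝ) (q : Q) :
    A.transitionOp s f q = ∫ q', f q' ∂(A.trans q s).toMeasure :=
  rfl

theorem abs_transitionOp_le (A : ProbWeightedAutomaton Q S) (s : S) {f : Q → ℝ} {C : ℝ}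
    (hf : ∀ q, |f q| ≤ C) (q : Q) : |A.transitionOp s f q| ≤ C := by
  have h := norm_integral_le_of_norm_le_const (μ := (A.trans q s).toMeasure) (f := f)
    (ae_of_all _ hf)
  rwa [probReal_univ, mul_one] at h

theorem integral_mul_step (A : ProbWeightedAutomaton Q S) (w : InfWord S) {n : ℕ}
    {F : (ℕ → Q) → ℝ} (hF : DependsOn F (Finset.Iic n)) (φ : Q → Q → ℝ) :
    ∫ r, F r * φ (r n) (r (n + 1)) ∂A.runMeasure w =
      ∫ r, F r * A.transitionOp (w n) (φ (r n)) (r n) ∂A.runMeasure w := by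
  obtain ⟨G, rfl⟩ := dependsOn_iff_exists_comp.1 hF
  simp only [transitionOp_apply, ← integral_const_mul]
  exact integral_trajMeasure_frestrictLe_succ (X := fun _ => Q)
    (f := fun p : (Finset.Iic n → Q) × Q => G p.1 * φ (p.1 ⟨n, Finset.mem_Iic.2 le_rfl⟩) p.2)
    .of_finite

theorem ae_tendsto_cesaroMean_sub_transitionOp (A : ProbWeightedAutomaton Q S) (w : InfWord S)
    {φ : ℕ → Q → Q → ℝ} {C : ℝ} (hφ : ∀ i q q', |φ i q q'| ≤ C) :
    ∀ᵐ r ∂A.runMeasure w, Tendsto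
      (cesaroMean fun i => φ i (r i) (r (i + 1)) - A.transitionOp (w i) (φ i (r i)) (r i))
      atTop (𝓝 0) := by
  set D : ℕ → (ℕ → Q) → ℝ := fun i r =>
    φ i (r i) (r (i + 1)) - A.transitionOp (w i) (φ i (r i)) (r i)
  have hmeas : ∀ i, Measurable (D i) := fun i => by
    have hpair : Measurable fun r : ℕ → Q => (r i, r (i + 1)) := by fun_prop
    exact (Measurable.of_discrete (f := fun p : Q × Q =>
      φ i p.1 p.2 - A.transitionOp (w i) (φ i p.1) p.1)).comp hpair
  have hbound : ∀ i r, |D i r| ≤ C + C := fun i r =>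
    (abs_sub _ _).trans (add_le_add (hφ _ _ _) (A.abs_transitionOp_le _ (hφ i _) _))
  have hdep : ∀ i n, i < n → DependsOn (D i) (Finset.Iic n) := fun i n hin r r' h => by
    simp only [D]
    rw [h i (by simpa using hin.le), h (i + 1) (by simpa using hin)]
  have hcenter : ∀ i q, A.transitionOp (w i)
      (fun q' => φ i q q' - A.transitionOp (w i) (φ i q) q) q = 0 := fun i q => by
    rw [transitionOp_apply, integral_sub .of_finite .of_finite, integral_const, probReal_univ,
      one_smul, transitionOp_apply, sub_self]
  have horth : ∀ i n, i < n → ∫ r, D i r * D n r ∂A.runMeasure w = 0 := fun i n hin => by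
    rw [A.integral_mul_step w (hdep i n hin)
      fun q q' => φ n q q' - A.transitionOp (w n) (φ n q) q]
    simp only [hcenter, mul_zero, integral_zero]
  refine ae_tendsto_cesaroMean_of_pairwise_orthogonal (fun i => (hmeas i).aestronglyMeasurable)
    (fun i => ae_of_all _ (hbound i)) fun i j hij => ?_
  rcases hij.lt_or_gt with h | h
  · exact horth i j h
  · simpa only [mul_comm] using horth j i h

theorem ae_mem_runs (A : ProbWeightedAutomaton Q S) (w : InfWord S) :
    ∀ᵐ r ∂A.runMeasure w, r ∈ A.runs w := by
  filter_upwards [ae_all_iff.2 fun k => ae_measure_preimage_singleton_ne_zero (A.runMeasure w)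
    (Preorder.frestrictLe (π := fun _ => Q) k)] with r hr
  have hcyl : ∀ k, A.init (r 0) ≠ 0 ∧
      ∀ i < k, A.trans (r i) (w i) (r (i + 1)) ≠ 0 := fun k => by
    have hpre : Preorder.frestrictLe (π := fun _ => Q) k ⁻¹' {Preorder.frestrictLe k r} =
        {r' | ∀ i ≤ k, r' i = r i} := by
      ext r'
      simp [funext_iff]
    simpa [hpre, runMeasure_cylinder, Finset.prod_eq_zero_iff] using hr k
  exact ⟨pos_iff_ne_zero.2 (hcyl 0).1,
    fun i => pos_iff_ne_zero.2 ((hcyl (i + 1)).2 i i.lt_succ_self)⟩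

end ProbWeightedAutomaton

theorem measurable_limAvg : Measurable limAvg := by
  refine Measurable.liminf fun n => Measurable.const_mul ?_ _
  exact Finset.measurable_sum _ fun i _ =>
    (Measurable.of_discrete (f := ((↑) : ℚ → ℝ))).comp (measurable_pi_apply i)

namespace ProbWeightedAutomaton

section Values

variable {Q S : Type*} [Finite Q] [MeasurableSpace Q] [DiscreteMeasurableSpace Q]
  {A : ProbWeightedAutomaton Q S} {w : InfWord S} {Val : (ℕ → ℚ) → ℝ} {B c : ℝ}

theorem measurable_weights (A : ProbWeightedAutomaton Q S) (w : InfWord S) :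
    Measurable (A.weights w) := by
  refine measurable_pi_lambda _ fun i => ?_
  have hpair : Measurable fun r : ℕ → Q => (r i, r (i + 1)) := by fun_prop
  exact (Measurable.of_discrete (f := fun p : Q × Q => A.weight p.1 (w i) p.2)).comp hpair

theorem runMeasure_setOf_mem_runs_and (A : ProbWeightedAutomaton Q S) (w : InfWord S)
    (p : (ℕ → Q) → Prop) :
    A.runMeasure w {r | r ∈ A.runs w ∧ p r} = A.runMeasure w {r | p r} := by
  refine measure_congr ?_
  filter_upwards [A.ae_mem_runs w] with r hr
  exact propext (and_iff_right hr)

theorem posValue_eq_sSup (Val : (ℕ → ℚ) → ℝ) (A : ProbWeightedAutomaton Q S) (w : InfWord S) :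
    A.posValue Val w = sSup {η | ∃ᵐ r ∂A.runMeasure w, η ≤ Val (A.weights w r)} := by
  simp only [posValue, runMeasure_setOf_mem_runs_and, frequently_ae_iff, pos_iff_ne_zero]

theorem asValue_eq_sSup (hVal : Measurable Val) (A : ProbWeightedAutomaton Q S)
    (w : InfWord S) :
    A.asValue Val w = sSup {η | ∀ᵐ r ∂A.runMeasure w, η ≤ Val (A.weights w r)} := by
  simp only [asValue, runMeasure_setOf_mem_runs_and]
  congr! 3 with η
  exact (mem_ae_iff_prob_eq_one
    (measurableSet_le measurable_const (hVal.comp (A.measurable_weights w)))).symm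

theorem posValue_eq_of_ae_eq (h : ∀ᵐ r ∂A.runMeasure w, Val (A.weights w r) = c) :
    A.posValue Val w = c := by
  have hset : {η | ∃ᵐ r ∂A.runMeasure w, η ≤ Val (A.weights w r)} = Set.Iic c := by
    ext η
    rw [Set.mem_ofPred_eq, frequently_congr (h.mono fun r hr => by rw [hr]), frequently_const,
      Set.mem_Iic]
  rw [posValue_eq_sSup, hset, csSup_Iic]

theorem asValue_eq_of_ae_eq (hVal : Measurable Val)
    (h : ∀ᵐ r ∂A.runMeasure w, Val (A.weights w r) = c) : A.asValue Val w = c := by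
  have hset : {η | ∀ᵐ r ∂A.runMeasure w, η ≤ Val (A.weights w r)} = Set.Iic c := by
    ext η
    rw [Set.mem_ofPred_eq, eventually_congr (h.mono fun r hr => by rw [hr]), eventually_const,
      Set.mem_Iic]
  rw [asValue_eq_sSup hVal, hset, csSup_Iic]

theorem posValue_le (hB : ∀ᵐ r ∂A.runMeasure w, B ≤ Val (A.weights w r))
    (h : ∀ᵐ r ∂A.runMeasure w, Val (A.weights w r) ≤ c) : A.posValue Val w ≤ c := by
  rw [posValue_eq_sSup]
  refine csSup_le ⟨B, hB.frequently⟩ fun η hη => ?_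
  obtain ⟨r, hηr, hrc⟩ := (hη.and_eventually h).exists
  exact hηr.trans hrc

theorem le_posValue (hB : ∀ᵐ r ∂A.runMeasure w, Val (A.weights w r) ≤ B)
    (h : ∃ᵐ r ∂A.runMeasure w, c ≤ Val (A.weights w r)) : c ≤ A.posValue Val w := by
  rw [posValue_eq_sSup]
  refine le_csSup ⟨B, fun η hη => ?_⟩ h
  obtain ⟨r, hηr, hrB⟩ := (hη.and_eventually hB).exists
  exact hηr.trans hrB

theorem asValue_le (hVal : Measurable Val) (hB : ∀ᵐ r ∂A.runMeasure w, B ≤ Val (A.weights w r))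
    (h : ∃ᵐ r ∂A.runMeasure w, Val (A.weights w r) ≤ c) : A.asValue Val w ≤ c := by
  rw [asValue_eq_sSup hVal]
  refine csSup_le ⟨B, hB⟩ fun η hη => ?_
  obtain ⟨r, hrc, hηr⟩ := (h.and_eventually hη).exists
  exact hηr.trans hrc

theorem le_asValue (hVal : Measurable Val) (hB : ∀ᵐ r ∂A.runMeasure w, Val (A.weights w r) ≤ B)
    (h : ∀ᵐ r ∂A.runMeasure w, c ≤ Val (A.weights w r)) : c ≤ A.asValue Val w := by
  rw [asValue_eq_sSup hVal]
  refine le_csSup ⟨B, fun η hη => ?_⟩ h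
  obtain ⟨r, hrB, hηr⟩ := (hB.and hη).exists
  exact hηr.trans hrB

end Values

section Bounds

variable {Q S : Type*} [Finite Q] [Finite S]

theorem exists_abs_weight_le (A : ProbWeightedAutomaton Q S) :
    ∃ B : ℝ, ∀ q s q', |(A.weight q s q' : ℝ)| ≤ B := by
  obtain ⟨B, hB⟩ := (Set.finite_range
    fun p : Q × S × Q => |(A.weight p.1 p.2.1 p.2.2 : ℝ)|).bddAbove
  exact ⟨B, fun q s q' => hB ⟨(q, s, q'), rfl⟩⟩

theorem exists_abs_limAvg_weights_le (A : ProbWeightedAutomaton Q S) :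
    ∃ B : ℝ, ∀ w r, |limAvg (A.weights w r)| ≤ B := by
  obtain ⟨B, hB⟩ := A.exists_abs_weight_le
  exact ⟨B, fun w r => abs_limAvg_le fun i => hB _ _ _⟩

end Bounds

end ProbWeightedAutomaton

theorem ae_toMeasure_iff {α : Type*} [MeasurableSpace α] [DiscreteMeasurableSpace α] (p : PMF α)
    {P : α → Prop} : (∀ᵐ x ∂p.toMeasure, P x) ↔ ∀ x, 0 < p x → P x := by
  rw [ae_iff, p.toMeasure_apply_eq_zero_iff .of_discrete, Set.disjoint_left]
  simp only [PMF.mem_support_iff, Set.mem_ofPred_eq, not_not, pos_iff_ne_zero]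

namespace ProbWeightedAutomaton

section Reachability

variable {Q S : Type*} {A : ProbWeightedAutomaton Q S}

/-- The state `q` is reachable if some word has a finite run that ends in `q`. Only the first `n`
letters of `w` and the first `n + 1` states of `r` matter. -/
def Reachable (A : ProbWeightedAutomaton Q S) (q : Q) : Prop :=
  ∃ (w : InfWord S) (r : ℕ → Q) (n : ℕ), 0 < A.init (r 0) ∧
    (∀ i < n, 0 < A.trans (r i) (w i) (r (i + 1))) ∧ r n = q

/-- The set `C` of states is closed under the letter `s` if `A` cannot leave it by reading `s`. -/
def IsClosedUnder (A : ProbWeightedAutomaton Q S) (s : S) (C : Set Q) : Prop :=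
  ∀ q ∈ C, ∀ q', 0 < A.trans q s q' → q' ∈ C

theorem reachable_of_mem_runs {w : InfWord S} {r : ℕ → Q} (hr : r ∈ A.runs w) (i : ℕ) :
    A.Reachable (r i) :=
  ⟨w, r, i, hr.1, fun j _ => hr.2 j, rfl⟩

theorem isClosedUnder_setOf_reachable (A : ProbWeightedAutomaton Q S) (s : S) :
    A.IsClosedUnder s {q | A.Reachable q} := by
  rintro _ ⟨w, r, n, h0, hr, rfl⟩ q' hq'
  refine ⟨fun i => if i < n then w i else s, fun i => if i ≤ n then r i else q', n + 1, by simpa,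
    fun i hi => ?_, by simp⟩
  rcases Nat.lt_succ_iff_lt_or_eq.1 hi with hi | rfl
  · simpa [hi, hi.le, Nat.succ_le_of_lt hi] using hr i hi
  · simpa using hq'

theorem IsClosedUnder.mem_of_mem_runs {s : S} {C : Set Q} (hC : A.IsClosedUnder s C)
    {w : InfWord S} {k : ℕ} (hw : ∀ i ≥ k, w i = s) {r : ℕ → Q} (hr : r ∈ A.runs w)
    (hk : r k ∈ C) {i : ℕ} (hi : k ≤ i) : r i ∈ C := by
  induction i, hi using Nat.le_induction with
  | base => exact hk
  | succ i hi ih => exact hC _ ih _ (hw i hi ▸ hr.2 i)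

variable [Finite Q] [MeasurableSpace Q] [DiscreteMeasurableSpace Q]

theorem Reachable.exists_runMeasure_pos {q : Q} (hq : A.Reachable q) :
    ∃ (u : InfWord S) (k : ℕ), ∀ w : InfWord S, (∀ i < k, w i = u i) →
      0 < A.runMeasure w {r | r k = q} := by
  obtain ⟨u, r, k, h0, hr, rfl⟩ := hq
  refine ⟨u, k, fun w hw => ?_⟩
  have hcyl : 0 < A.runMeasure w {r' | ∀ i ≤ k, r' i = r i} := by
    rw [runMeasure_cylinder]
    refine ENNReal.mul_pos h0.ne' (Finset.prod_ne_zero_iff.2 fun i hi => ?_)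
    rw [hw i (Finset.mem_range.1 hi)]
    exact (hr i (Finset.mem_range.1 hi)).ne'
  exact hcyl.trans_le (measure_mono fun r' hr' => hr' k le_rfl)

/-- Maximum principle: an average of values `≤ f p` can only equal `f p` if all of them do. -/
theorem isClosedUnder_setOf_eq_of_isMaxOn {s : S} {C : Set Q} (hC : A.IsClosedUnder s C)
    {f : Q → ℝ} (hf : A.transitionOp s f = f) {q : Q} (hq : IsMaxOn f C q) :
    A.IsClosedUnder s {p ∈ C | f p = f q} := by
  rintro p ⟨hp, hpq⟩ p' hp'
  refine ⟨hC p hp p' hp', ?_⟩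
  have hnonneg : ∀ᵐ x ∂(A.trans p s).toMeasure, 0 ≤ f q - f x :=
    (ae_toMeasure_iff _).2 fun x hx => sub_nonneg.2 (hq (hC p hp x hx))
  have hzero : ∫ x, f q - f x ∂(A.trans p s).toMeasure = 0 := by
    rw [integral_sub .of_finite .of_finite, ← transitionOp_apply _ _ f, hf, hpq]
    simp
  have hae := (integral_eq_zero_iff_of_nonneg_ae hnonneg .of_finite).1 hzero
  exact (sub_eq_zero.1 ((ae_toMeasure_iff _).1 hae p' hp')).symm

theorem isClosedUnder_setOf_eq_of_isMinOn {s : S} {C : Set Q} (hC : A.IsClosedUnder s C)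
    {f : Q → ℝ} (hf : A.transitionOp s f = f) {q : Q} (hq : IsMinOn f C q) :
    A.IsClosedUnder s {p ∈ C | f p = f q} := by
  have hneg : A.transitionOp s (-f) = -f := by rw [map_neg, hf]
  simpa using isClosedUnder_setOf_eq_of_isMaxOn hC hneg hq.neg

end Reachability

end ProbWeightedAutomaton

section SlowlySwitching

variable {S : Type*} {w : InfWord S}

/-- A word is slowly switching if the positions at which its letter changes have density zero. -/
def SlowlySwitching (w : InfWord S) : Prop :=
  Tendsto (cesaroMean ({i | w (i + 1) ≠ w i}.indicator 1)) atTop (𝓝 0)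

theorem slowlySwitching_of_eventually_eq {s : S} (hw : ∀ᶠ i in atTop, w i = s) :
    SlowlySwitching w := by
  refine tendsto_cesaroMean (tendsto_const_nhds.congr' ?_)
  filter_upwards [hw, (tendsto_add_atTop_nat 1).eventually hw] with i hi hi'
  simp [hi, hi']

/-- Letter-dependent potentials telescope except at the switches. -/
theorem SlowlySwitching.tendsto_cesaroMean_potential_sub {Q : Type*} (hw : SlowlySwitching w)
    {h : S → Q → ℝ} {H : ℝ} (hH : ∀ s q, |h s q| ≤ H) (r : ℕ → Q) :
    Tendsto (cesaroMean fun i => h (w i) (r (i + 1)) - h (w i) (r i)) atTop (𝓝 0) := by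
  have htelescope : Tendsto
      (cesaroMean fun i => h (w (i + 1)) (r (i + 1)) - h (w i) (r i)) atTop (𝓝 0) :=
    tendsto_cesaroMean_sub_succ (u := fun i => h (w i) (r i)) <|
      squeeze_zero_norm (fun n => by
        rw [norm_div, RCLike.norm_natCast]
        exact div_le_div_of_nonneg_right (hH _ _) n.cast_nonneg)
        (tendsto_const_div_atTop_nhds_zero_nat H)
  have hswitch : Tendsto
      (cesaroMean fun i => h (w (i + 1)) (r (i + 1)) - h (w i) (r (i + 1))) atTop (𝓝 0) := by
    refine tendsto_cesaroMean_of_abs_le (c := H + H) (fun i => ?_) hw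
    by_cases hi : w (i + 1) = w i
    · simp [hi]
    · simpa [hi] using (abs_sub _ _).trans (add_le_add (hH _ _) (hH _ _))
  refine (sub_zero (0 : ℝ) ▸ htelescope.sub hswitch).congr fun n => ?_
  rw [← cesaroMean_sub]
  simp only [sub_sub_sub_cancel_left]

end SlowlySwitching

namespace ProbWeightedAutomaton

section GainBias

variable {Q S : Type*} [Finite Q] [MeasurableSpace Q] [DiscreteMeasurableSpace Q]

/-- A gain `g` and a bias `h` for the letter `s`: the long-run average weight of `A` and the
correction to it, by the starting state, when `A` reads `s` forever. -/
structure IsGainBias (A : ProbWeightedAutomaton Q S) (s : S) (g h : Q → ℝ) : Prop where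
  harmonic : A.transitionOp s g = g
  poisson : ∀ q, A.transitionOp s (fun q' => A.weight q s q' + h q') q = g q + h q

theorem exists_isGainBias (A : ProbWeightedAutomaton Q S) (s : S) : ∃ g h, A.IsGainBias s g h := by
  have := Fintype.ofFinite Q
  have hiter : ∀ (f : Q → ℝ) (n : ℕ) (q : Q), |(A.transitionOp s)^[n] f q| ≤ ‖f‖ := fun f n => by
    induction n with
    | zero => exact norm_le_pi_norm f
    | succ n ih =>
      rw [Function.iterate_succ_apply']
      exact A.abs_transitionOp_le s ih
  have hbdd : ∀ f, Bornology.IsBounded (Set.range fun n => (A.transitionOp s)^[n] f) := fun f =>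
    isBounded_iff_forall_norm_le.2 ⟨‖f‖, Set.forall_mem_range.2 fun n =>
      (pi_norm_le_iff_of_nonneg (norm_nonneg f)).2 (hiter f n)⟩
  obtain ⟨g, h, hg, hgh⟩ := exists_poisson_solution hbdd
    fun q => A.transitionOp s (fun q' => (A.weight q s q' : ℝ)) q
  refine ⟨g, h, hg, fun q => ?_⟩
  rw [← Pi.add_apply g h, ← hgh]
  exact congrFun (map_add (A.transitionOp s) (fun q' => (A.weight q s q' : ℝ)) h) q

variable [Finite S] {A : ProbWeightedAutomaton Q S} {g h : S → Q → ℝ} {w : InfWord S} {c : ℝ}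

theorem ae_tendsto_cesaroMean_weights_sub_gain (hgh : ∀ s, A.IsGainBias s (g s) (h s))
    (hw : SlowlySwitching w) :
    ∀ᵐ r ∂A.runMeasure w,
      Tendsto (cesaroMean fun i => A.weights w r i - g (w i) (r i)) atTop (𝓝 0) := by
  obtain ⟨B, hB⟩ := A.exists_abs_weight_le
  obtain ⟨H, hH⟩ := (Set.finite_range fun p : S × Q => |h p.1 p.2|).bddAbove
  have hH' : ∀ s q, |h s q| ≤ H := fun s q => hH ⟨(s, q), rfl⟩
  filter_upwards [A.ae_tendsto_cesaroMean_sub_transitionOp w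
    (φ := fun i q q' => A.weight q (w i) q' + h (w i) q')
    fun i q q' => (abs_add_le _ _).trans (add_le_add (hB q (w i) q') (hH' (w i) q'))] with r hr
  refine (sub_zero (0 : ℝ) ▸ hr.sub (hw.tendsto_cesaroMean_potential_sub hH' r)).congr fun n => ?_
  rw [← cesaroMean_sub]
  congr 1 with i
  rw [(hgh (w i)).poisson, weights]
  ring

theorem ae_limAvg_le (hgh : ∀ s, A.IsGainBias s (g s) (h s)) (hw : SlowlySwitching w)
    (hg : ∀ s q, A.Reachable q → g s q ≤ c) :
    ∀ᵐ r ∂A.runMeasure w, limAvg (A.weights w r) ≤ c := by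
  obtain ⟨B, hB⟩ := A.exists_abs_weight_le
  filter_upwards [ae_tendsto_cesaroMean_weights_sub_gain hgh hw, A.ae_mem_runs w] with r hr hrun
  exact limAvg_le_of_tendsto_sub (fun i => (abs_le.1 (hB _ _ _)).1)
    (fun i => hg _ _ (reachable_of_mem_runs hrun i)) hr

theorem ae_le_limAvg (hgh : ∀ s, A.IsGainBias s (g s) (h s)) (hw : SlowlySwitching w)
    (hg : ∀ s q, A.Reachable q → c ≤ g s q) :
    ∀ᵐ r ∂A.runMeasure w, c ≤ limAvg (A.weights w r) := by
  obtain ⟨B, hB⟩ := A.exists_abs_weight_le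
  filter_upwards [ae_tendsto_cesaroMean_weights_sub_gain hgh hw, A.ae_mem_runs w] with r hr hrun
  exact le_limAvg_of_tendsto_sub (fun i => (abs_le.1 (hB _ _ _)).2)
    (fun i => hg _ _ (reachable_of_mem_runs hrun i)) hr

theorem exists_frequently_limAvg_eq (hgh : ∀ s, A.IsGainBias s (g s) (h s)) {s : S} {q : Q}
    {C : Set Q} (hC : A.IsClosedUnder s C) (hq : A.Reachable q) (hqC : q ∈ C)
    (hg : ∀ p ∈ C, g s p = c) :
    ∃ w : InfWord S, (∀ᶠ i in atTop, w i = s) ∧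
      ∃ᵐ r ∂A.runMeasure w, limAvg (A.weights w r) = c := by
  obtain ⟨u, k, hu⟩ := hq.exists_runMeasure_pos
  set w : InfWord S := fun i => if i < k then u i else s
  have hwu : ∀ i < k, w i = u i := fun i hi => if_pos hi
  have hws : ∀ i ≥ k, w i = s := fun i hi => if_neg hi.not_gt
  have hw : ∀ᶠ i in atTop, w i = s := eventually_atTop.2 ⟨k, hws⟩
  have hvisit : ∃ᵐ r ∂A.runMeasure w, r k = q := frequently_ae_iff.2 (hu w hwu).ne'
  refine ⟨w, hw, (hvisit.and_eventually ((ae_tendsto_cesaroMean_weights_sub_gain hgh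
    (slowlySwitching_of_eventually_eq hw)).and (A.ae_mem_runs w))).mono ?_⟩
  rintro r ⟨hrk, hr, hrun⟩
  have hgain : Tendsto (fun i => g (w i) (r i)) atTop (𝓝 c) :=
    tendsto_const_nhds.congr' <| (eventually_ge_atTop k).mono fun i hi => by
      simp only [hws i hi, hg _ (hC.mem_of_mem_runs hws hrun (hrk ▸ hqC) hi)]
  refine limAvg_eq_of_tendsto ((zero_add c ▸ hr.add (tendsto_cesaroMean hgain)).congr fun n => ?_)
  rw [← cesaroMean_add]
  simp only [sub_add_cancel]

theorem posValue_le_of_slowlySwitching (A : ProbWeightedAutomaton Q S)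
    (hc : ∀ (w : InfWord S) (s : S), (∀ᶠ i in atTop, w i = s) → A.posValue limAvg w ≤ c)
    (hw : SlowlySwitching w) : A.posValue limAvg w ≤ c := by
  obtain ⟨B, hB⟩ := A.exists_abs_limAvg_weights_le
  choose g h hgh using A.exists_isGainBias
  refine posValue_le (ae_of_all _ fun r => (abs_le.1 (hB w r)).1)
    (ae_limAvg_le hgh hw fun s q₀ hq₀ => ?_)
  obtain ⟨q, hq, hmax⟩ := Set.exists_max_image {q | A.Reachable q} (g s) (Set.toFinite _) ⟨q₀, hq₀⟩
  have hclosed := isClosedUnder_setOf_eq_of_isMaxOn (A.isClosedUnder_setOf_reachable s)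
    (hgh s).harmonic hmax
  obtain ⟨w', hw', hfreq⟩ :=
    exists_frequently_limAvg_eq hgh hclosed hq ⟨hq, rfl⟩ fun _ hp => hp.2
  calc g s q₀ ≤ g s q := hmax q₀ hq₀
    _ ≤ A.posValue limAvg w' := le_posValue (ae_of_all _ fun r => (abs_le.1 (hB w' r)).2)
        (hfreq.mono fun _ hr => hr.ge)
    _ ≤ c := hc w' s hw'

theorem le_asValue_of_slowlySwitching (A : ProbWeightedAutomaton Q S)
    (hc : ∀ (w : InfWord S) (s : S), (∀ᶠ i in atTop, w i = s) → c ≤ A.asValue limAvg w)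
    (hw : SlowlySwitching w) : c ≤ A.asValue limAvg w := by
  obtain ⟨B, hB⟩ := A.exists_abs_limAvg_weights_le
  choose g h hgh using A.exists_isGainBias
  refine le_asValue measurable_limAvg (ae_of_all _ fun r => (abs_le.1 (hB w r)).2)
    (ae_le_limAvg hgh hw fun s q₀ hq₀ => ?_)
  obtain ⟨q, hq, hmin⟩ := Set.exists_min_image {q | A.Reachable q} (g s) (Set.toFinite _) ⟨q₀, hq₀⟩
  have hclosed := isClosedUnder_setOf_eq_of_isMinOn (A.isClosedUnder_setOf_reachable s)
    (hgh s).harmonic hmin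
  obtain ⟨w', hw', hfreq⟩ :=
    exists_frequently_limAvg_eq hgh hclosed hq ⟨hq, rfl⟩ fun _ hp => hp.2
  calc c ≤ A.asValue limAvg w' := hc w' s hw'
    _ ≤ g s q := asValue_le measurable_limAvg (ae_of_all _ fun r => (abs_le.1 (hB w' r)).1)
        (hfreq.mono fun _ hr => hr.le)
    _ ≤ g s q₀ := hmin q₀ hq₀

end GainBias

end ProbWeightedAutomaton

section Definable

variable {S : Type} [Finite S] {L : QuantLanguage S} {w : InfWord S} {c : ℝ}

theorem apply_le_of_mem_posLimAvg (hL : L ∈ PosLimAvg S)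
    (hc : ∀ (w : InfWord S) (s : S), (∀ᶠ i in atTop, w i = s) → L w ≤ c)
    (hw : SlowlySwitching w) : L w ≤ c := by
  obtain ⟨Q, _, _, _, A, rfl⟩ := hL
  exact A.posValue_le_of_slowlySwitching hc hw

theorem le_apply_of_mem_asLimAvg (hL : L ∈ AsLimAvg S)
    (hc : ∀ (w : InfWord S) (s : S), (∀ᶠ i in atTop, w i = s) → c ≤ L w)
    (hw : SlowlySwitching w) : c ≤ L w := by
  obtain ⟨Q, _, _, _, A, rfl⟩ := hL
  exact A.le_asValue_of_slowlySwitching hc hw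

end Definable

section LetterCounter

/-- The deterministic one-state automaton that counts the letter `c`. -/
noncomputable def letterCounter (c : Letter) : ProbWeightedAutomaton Unit Letter where
  init := PMF.pure ()
  trans _ _ := PMF.pure ()
  weight _ s _ := if s = c then 1 else 0

theorem limAvg_weights_letterCounter (c : Letter) (w : InfWord Letter) (r : ℕ → Unit) :
    limAvg ((letterCounter c).weights w r) = letterFreq c w :=
  rfl

theorem letterFreq_mem_posLimAvg (c : Letter) : letterFreq c ∈ PosLimAvg Letter :=
  ⟨Unit, inferInstance, inferInstance, inferInstance, letterCounter c, funext fun w =>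
    ProbWeightedAutomaton.posValue_eq_of_ae_eq <|
      ae_of_all _ (limAvg_weights_letterCounter c w)⟩

theorem letterFreq_mem_asLimAvg (c : Letter) : letterFreq c ∈ AsLimAvg Letter :=
  ⟨Unit, inferInstance, inferInstance, inferInstance, letterCounter c, funext fun w =>
    ProbWeightedAutomaton.asValue_eq_of_ae_eq measurable_limAvg <|
      ae_of_all _ (limAvg_weights_letterCounter c w)⟩

end LetterCounter

section OddBlockWord

theorem letterFreq_of_eventually_eq {c s : Letter} {w : InfWord Letter}
    (hw : ∀ᶠ i in atTop, w i = s) : letterFreq c w = if s = c then 1 else 0 := by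
  refine limAvg_eq_of_tendsto (tendsto_cesaroMean (tendsto_const_nhds.congr' ?_))
  filter_upwards [hw] with i hi
  rw [hi]
  split_ifs <;> simp

theorem tendsto_sqrt_div_atTop : Tendsto (fun n : ℕ => (n.sqrt : ℝ) / n) atTop (𝓝 0) := by
  have hlim : Tendsto (fun n : ℕ => (√(n : ℝ))⁻¹) atTop (𝓝 0) :=
    (Real.tendsto_sqrt_atTop.comp tendsto_natCast_atTop_atTop).inv_tendsto_atTop
  refine squeeze_zero (fun n => by positivity) (fun n => ?_) hlim
  rw [← Real.sqrt_div_self]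
  gcongr
  exact Real.nat_sqrt_le_real_sqrt

theorem sqrt_succ_eq_or (n : ℕ) : (n + 1).sqrt = n.sqrt ∨
    (n + 1).sqrt = n.sqrt + 1 ∧ n + 1 = (n.sqrt + 1) ^ 2 := by
  rcases (Nat.sqrt_le_sqrt n.le_succ).eq_or_lt with heq | hlt
  · exact .inl heq.symm
  · have hsqrt : (n + 1).sqrt = n.sqrt + 1 := (Nat.sqrt_succ_le_succ_sqrt n).antisymm hlt
    have hle := Nat.sqrt_le' (n + 1)
    rw [hsqrt] at hle
    exact .inr ⟨hsqrt, le_antisymm (Nat.lt_succ_sqrt' n) hle⟩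

/-- The word `a b b b a a a a a …` whose blocks of equal letters have lengths `1, 3, 5, …`. -/
def oddBlockWord : InfWord Letter :=
  fun i => if Even i.sqrt then Letter.a else Letter.b

theorem slowlySwitching_oddBlockWord : SlowlySwitching oddBlockWord := by
  refine tendsto_cesaroMean_of_abs_le (c := 1) (fun i => ?_)
    (tendsto_cesaroMean_sub_succ tendsto_sqrt_div_atTop)
  by_cases hi : oddBlockWord (i + 1) = oddBlockWord i
  · simpa [hi] using Nat.sqrt_le_sqrt i.le_succ
  · rcases sqrt_succ_eq_or i with hsqrt | ⟨hsqrt, -⟩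
    · simp [oddBlockWord, hsqrt] at hi
    · simp [hi, hsqrt]

theorem tendsto_cesaroMean_neg_one_pow_sqrt :
    Tendsto (cesaroMean fun i => (-1) ^ i.sqrt) atTop (𝓝 0) := by
  -- On the block `[m², (m + 1)²)` the partial sums run from `-(-1)^m m` to `(-1)^m (m + 1)`.
  set u : ℕ → ℝ := fun n => (-1) ^ n.sqrt * (n - n.sqrt ^ 2 - n.sqrt)
  have hdiff : ∀ n, u (n + 1) - u n = (-1) ^ n.sqrt := fun n => by
    rcases sqrt_succ_eq_or n with hsqrt | ⟨hsqrt, hn⟩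
    · simp only [u, hsqrt]
      push_cast
      ring
    · have hn' : (n : ℝ) = (n.sqrt + 1) ^ 2 - 1 := eq_sub_of_add_eq (by exact_mod_cast hn)
      simp only [u, hsqrt]
      push_cast
      rw [pow_succ]
      linear_combination (-2 * (-1) ^ n.sqrt) * hn'
  have hbound : ∀ n, |u n| ≤ n.sqrt := fun n => by
    have hle : (n.sqrt : ℝ) ^ 2 ≤ n := by exact_mod_cast Nat.sqrt_le' n
    have hge : (n : ℝ) ≤ n.sqrt * n.sqrt + n.sqrt + n.sqrt := by exact_mod_cast Nat.sqrt_le_add n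
    rw [abs_mul, abs_pow, abs_neg, abs_one, one_pow, one_mul, abs_le]
    constructor <;> linarith
  simp only [← hdiff]
  refine tendsto_cesaroMean_sub_succ (squeeze_zero_norm (fun n => ?_) tendsto_sqrt_div_atTop)
  rw [norm_div, RCLike.norm_natCast]
  exact div_le_div_of_nonneg_right (hbound n) n.cast_nonneg

theorem letterFreq_oddBlockWord (c : Letter) : letterFreq c oddBlockWord = 1 / 2 := by
  obtain ⟨δ, hδ⟩ : ∃ δ : ℝ, ∀ i,
      ((if oddBlockWord i = c then 1 else 0 : ℚ) : ℝ) = 1 / 2 + δ * (-1) ^ i.sqrt := by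
    refine ⟨if c = Letter.a then 1 / 2 else -(1 / 2), fun i => ?_⟩
    rcases i.sqrt.even_or_odd with h | h
    · rw [oddBlockWord, if_pos h, h.neg_one_pow]
      cases c <;> grind [Rat.cast_one, Rat.cast_zero]
    · rw [oddBlockWord, if_neg (Nat.not_even_iff_odd.2 h), h.neg_one_pow]
      cases c <;> grind [Rat.cast_one, Rat.cast_zero]
  have hlim := (tendsto_cesaroMean (tendsto_const_nhds (x := 1 / 2))).add
    (tendsto_cesaroMean_neg_one_pow_sqrt.const_mul δ)
  rw [mul_zero, add_zero] at hlim
  refine limAvg_eq_of_tendsto (hlim.congr fun n => ?_)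
  simp only [hδ]
  rw [cesaroMean_add, cesaroMean_const_mul]

end OddBlockWord

instance : Finite Letter :=
  Finite.of_injective (fun c => decide (c = Letter.a)) fun c c' => by
    cases c <;> cases c' <;> simp

theorem min_letterFreq_notMem_posLimAvg :
    (fun w => min (letterFreq Letter.a w) (letterFreq Letter.b w)) ∉ PosLimAvg Letter := by
  intro hL
  have hle := apply_le_of_mem_posLimAvg (c := 0) hL (fun w s hw => by
    cases s <;> simp [letterFreq_of_eventually_eq hw]) slowlySwitching_oddBlockWord
  norm_num [letterFreq_oddBlockWord] at hle

theorem one_sub_max_letterFreq_notMem_posLimAvg :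
    (fun w => 1 - max (letterFreq Letter.a w) (letterFreq Letter.b w)) ∉ PosLimAvg Letter := by
  intro hL
  have hle := apply_le_of_mem_posLimAvg (c := 0) hL (fun w s hw => by
    cases s <;> simp [letterFreq_of_eventually_eq hw]) slowlySwitching_oddBlockWord
  norm_num [letterFreq_oddBlockWord] at hle

theorem max_letterFreq_notMem_asLimAvg :
    (fun w => max (letterFreq Letter.a w) (letterFreq Letter.b w)) ∉ AsLimAvg Letter := by
  intro hL
  have hle := le_apply_of_mem_asLimAvg (c := 1) hL (fun w s hw => by
    cases s <;> simp [letterFreq_of_eventually_eq hw]) slowlySwitching_oddBlockWord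
  norm_num [letterFreq_oddBlockWord] at hle

theorem mainTheorem7 :
    (letterFreq Letter.a ∈ PosLimAvg Letter ∧ letterFreq Letter.b ∈ PosLimAvg Letter ∧
      (fun w => min (letterFreq Letter.a w) (letterFreq Letter.b w)) ∉ PosLimAvg Letter ∧
      (fun w => 1 - max (letterFreq Letter.a w) (letterFreq Letter.b w)) ∉ PosLimAvg Letter) ∧
    (letterFreq Letter.a ∈ AsLimAvg Letter ∧ letterFreq Letter.b ∈ AsLimAvg Letter ∧
      (fun w => max (letterFreq Letter.a w) (letterFreq Letter.b w)) ∉ AsLimAvg Letter) ∧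
    ¬ ClosedUnderMin PosLimAvg ∧ ¬ ClosedUnderMax AsLimAvg :=
  ⟨⟨letterFreq_mem_posLimAvg _, letterFreq_mem_posLimAvg _, min_letterFreq_notMem_posLimAvg,
    one_sub_max_letterFreq_notMem_posLimAvg⟩,
    ⟨letterFreq_mem_asLimAvg _, letterFreq_mem_asLimAvg _, max_letterFreq_notMem_asLimAvg⟩,
    fun h => min_letterFreq_notMem_posLimAvg
      (h Letter _ _ (letterFreq_mem_posLimAvg _) (letterFreq_mem_posLimAvg _)),
    fun h => max_letterFreq_notMem_asLimAvg
      (h Letter _ _ (letterFreq_mem_asLimAvg _) (letterFreq_mem_asLimAvg _))⟩
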